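/- Let $N\ge 1$ and let $p_1<p_2<\cdots$ be the primes. For $m=\prod_i p_i^{a_i}$ put $\log(m)=(a_1,a_2,\dots)$, $\Omega(m)=\sum_i a_i$, and for a vector $\alpha$ of non-negative integers let $\underline{\alpha}$ be its reduction modulo $2$, with entries in $\{0,1\}$; the squarefree part of $m$ is $\operatorname{sfp}(m)=\prod_i p_i^{\underline{a_i}}$ (the product of the primes that have odd exponent in $m$). Identify $m$ with the monomial $\prod_i x_i^{a_i}$, so that $M_N=\{1,\dots,N\}$ becomes a finite set of monomials closed under taking divisors (a multicomplex), and let $M_{N,d}$ be the set of its elements with $\Omega=d$. Let $\partial_d:\mathbb{R}M_{N,d}\to\mathbb{R}M_{N,d-1}$ be the Björner–Vrećica boundary map $$\partial_d\Big(\prod_i x_i^{a_i}\Big)=\sum_{j:\ a_j\text{ odd}}(-1)^{a_1+\cdots+a_{j-1}}\,x_j^{-1}\prod_i x_i^{a_i},$$ let $\partial_d^*$ be its adjoint for the inner products in which the monomials are orthonormal, and for $k\ge 0$ let $L'_k=\partial_{k+1}\partial_{k+1}^*$, acting on $\mathbb{R}M_{N,k}$. Then for every $k\ge 0$ the eigenvalues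 of $L'_k$ are non-negative integers. Let $\boldsymbol{s}'_k(N)=(s_k^1(N),s_k^2(N),\dots)$ be the eigenvalues, with multiplicities, in weakly decreasing order and continued by zeros, and let $\boldsymbol{s}'_k(N)^T=(t_k^1(N),t_k^2(N),\dots)$ be the conjugate partition. Then $$\boldsymbol{s}'_k(N)^T=\sum_{\substack{1\le \ell\le N\\ \Omega(\ell)=k+1}}\underline{\log(\ell)}=\sum_{\substack{1\le \ell\le N\\ \Omega(\ell)=k+1}}\log(\operatorname{sfp}(\ell)),$$ and for all $i,j\ge 1$ $$t_k^i(N)=\#\{\,1<n\le N : \Omega(n)=k+1,\ p_i\mid\operatorname{sfp}(n)\,\},$$ $$s_k^j(N)=\#\{\,i\ge1 : t_k^i(N)\ge j\,\}=\#\big\{\,\ell\ge1 : \#\{1<n\le N : \Omega(n)=k+1,\ p_\ell\mid\operatorname{sfp}(n)\}\ge j\,\big\}.$$ -/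

import Mathlib

/-- A multicomplex on a totally ordered set `X` of variables: a finite set of monomials that is
closed under taking divisors.  The monomial `∏ x ^ (m x)` is represented by its exponent vector
`m : X →₀ ℕ`, so divisibility of monomials is the pointwise order.  As the set of monomials is
finite, only finitely many variables occur in it, also when `X` itself is infinite. -/
structure Multicomplex (X : Type*) where
  /-- The monomials of the multicomplex. -/
  carrier : Finset (X →₀ ℕ)
  down_closed : ∀ m t : X →₀ ℕ, m ≤ t → t ∈ carrier → m ∈ carrier

namespace Multicomplex

variable {X : Type*}

/-- `M_d`: the monomials of total degree `d` in the multicomplex. -/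
noncomputable def level (M : Multicomplex X) (d : ℕ) : Finset (X →₀ ℕ) :=
  M.carrier.filter (fun m => m.degree = d)

/-- The Björner–Vrećica boundary operator on `ℝ[X]`, on the basis of all monomials:
`∂ m = ∑_j (-1)^(∑_{i<j} m i) r_j (m / x_j)`, with `r_j = 1` if the exponent of `x_j` in `m`
is odd and `r_j = 0` if it is even. -/
noncomputable def polyBoundary [LinearOrder X] :
    ((X →₀ ℕ) →₀ ℝ) →ₗ[ℝ] ((X →₀ ℕ) →₀ ℝ) :=
  Finsupp.linearCombination ℝ (fun m : X →₀ ℕ =>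
    ∑ j ∈ m.support.filter (fun j => Odd (m j)),
      Finsupp.single (m - Finsupp.single j 1)
        ((-1 : ℝ) ^ (∑ i ∈ m.support.filter (fun i => i < j), m i)))

/-- The boundary of a monomial of `M_{d+1}` is a linear combination of monomials of `M_d`. -/
theorem support_polyBoundary [LinearOrder X] (M : Multicomplex X) (d : ℕ)
    (m : X →₀ ℕ) (hm : m ∈ M.level (d + 1)) :
    (polyBoundary (Finsupp.single m 1)).support ⊆ M.level d := by
  classical
  simp only [level, Finset.mem_filter] at hm
  obtain ⟨hm, hd⟩ := hm
  unfold polyBoundary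
  rw [Finsupp.linearCombination_single, one_smul]
  refine Finsupp.support_finsetSum.trans ?_
  intro a ha
  rw [Finset.mem_biUnion] at ha
  obtain ⟨j, hj, ha⟩ := ha
  obtain rfl := Finset.mem_singleton.1 (Finsupp.support_single_subset ha)
  simp only [Finset.mem_filter, Finsupp.mem_support_iff] at hj
  simp only [level, Finset.mem_filter]
  refine ⟨M.down_closed _ m tsub_le_self hm, ?_⟩
  have hle : Finsupp.single j 1 ≤ m := by
    rw [Finsupp.single_le_iff]
    exact Nat.one_le_iff_ne_zero.2 hj.1
  have h := congrArg Finsupp.degree (tsub_add_cancel_of_le hle)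
  rw [map_add, Finsupp.degree_single] at h
  omega

/-- `ℝ M_d`, with the inner product for which the monomials are an orthonormal basis. -/
abbrev Chains (M : Multicomplex X) (d : ℕ) : Type _ :=
  EuclideanSpace ℝ {m : X →₀ ℕ // m ∈ M.level d}

/-- `∂_{d+1} : ℝ M_{d+1} → ℝ M_d`, the restriction of the boundary operator, given by its matrix
with respect to the bases of monomials. -/
noncomputable def boundary [LinearOrder X] (M : Multicomplex X) (d : ℕ) :
    M.Chains (d + 1) →ₗ[ℝ] M.Chains d :=
  Matrix.toEuclideanLin (Matrix.of fun
    (a : {m : X →₀ ℕ // m ∈ M.level d}) (b : {m : X →₀ ℕ // m ∈ M.level (d + 1)}) =>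
      polyBoundary (Finsupp.single b.1 1) a.1)

/-- `L'_d = ∂_{d+1} ∂_{d+1}^*`, an operator on `ℝ M_d`. -/
noncomputable def laplacian' [LinearOrder X] (M : Multicomplex X) (d : ℕ) :
    M.Chains d →ₗ[ℝ] M.Chains d :=
  M.boundary d ∘ₗ LinearMap.adjoint (M.boundary d)

/-- The multiset of the eigenvalues of the self-adjoint operator `L'_d`, with multiplicities. -/
noncomputable def eigenvalues' [LinearOrder X] (M : Multicomplex X) (d : ℕ) : Multiset ℝ :=
  (M.laplacian' d).charpoly.roots

/-- The spectrum `s'_d` of `L'_d` as a weakly decreasing sequence: the eigenvalues in weakly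
decreasing order, continued by zeros.  Indices start at `0`, so `M.spectrum' d j` is the
`(j + 1)`-st part. -/
noncomputable def spectrum' [LinearOrder X] (M : Multicomplex X) (d : ℕ) (j : ℕ) : ℝ :=
  ((M.eigenvalues' d).sort (· ≥ ·)).getD j 0

end Multicomplex

/-- The conjugate of a partition `a` (a weakly decreasing sequence of nonnegative integers that is
eventually zero, with values regarded as real numbers): its `(i + 1)`-st part is the number of
parts of `a` that are at least `i + 1`. -/
noncomputable def conjugatePartition (a : ℕ → ℝ) (i : ℕ) : ℕ :=
  {j : ℕ | ((i + 1 : ℕ) : ℝ) ≤ a j}.ncard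

/-- `nthPrime i` is the `(i + 1)`-st prime number: `2, 3, 5, …`. -/
noncomputable def nthPrime (i : ℕ) : ℕ := Nat.nth Nat.Prime i

theorem nthPrime_prime (i : ℕ) : (nthPrime i).Prime := Nat.prime_nth_prime i

theorem nthPrime_injective : Function.Injective nthPrime :=
  Nat.nth_injective Nat.infinite_setOfPred_prime

/-- `log m`: the vector of the exponents of the primes `2, 3, 5, …` in `m`. -/
noncomputable def primeLog (m : ℕ) : ℕ →₀ ℕ :=
  m.factorization.comapDomain nthPrime nthPrime_injective.injOn

theorem primeLog_apply (m i : ℕ) : primeLog m i = m.factorization (nthPrime i) := rfl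

/-- `p ^ α = ∏ p_i ^ α_i`. -/
noncomputable def primePow (α : ℕ →₀ ℕ) : ℕ := α.prod (fun i a => nthPrime i ^ a)

theorem primePow_ne_zero (α : ℕ →₀ ℕ) : primePow α ≠ 0 :=
  Finset.prod_ne_zero_iff.2 fun i _ => pow_ne_zero _ (nthPrime_prime i).ne_zero

theorem primeLog_primePow (α : ℕ →₀ ℕ) : primeLog (primePow α) = α := by
  classical
  ext j
  rw [primeLog_apply, primePow, Finsupp.prod,
    Nat.factorization_prod fun i _ => pow_ne_zero _ (nthPrime_prime i).ne_zero,
    Finsupp.finsetSum_apply]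
  simp only [(nthPrime_prime _).factorization_pow, Finsupp.single_apply,
    nthPrime_injective.eq_iff]
  simp [eq_comm]

/-- Reduction of an exponent vector modulo 2: entries are `1` where `α` is odd, else `0`. -/
noncomputable def parityVector (α : ℕ →₀ ℕ) : ℕ →₀ ℕ := α.mapRange (fun a => a % 2) rfl

/-- The squarefree part of `m`: the product of the primes with odd exponent in `m`. -/
noncomputable def squarefreePart (m : ℕ) : ℕ := primePow (parityVector (primeLog m))

/-- The multicomplex `M_N = {1, …, N}`, each integer being identified with the monomial given by
its prime factorisation (the variable with index `i` corresponds to the prime `nthPrime i`). -/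
noncomputable def intMulticomplex (N : ℕ) : Multicomplex ℕ where
  carrier := (Finset.Icc 1 N).image primeLog
  down_closed := by
    intro m t hmt ht
    rw [Finset.mem_image] at ht ⊢
    obtain ⟨n, hn, rfl⟩ := ht
    rw [Finset.mem_Icc] at hn
    refine ⟨primePow m, ?_, primeLog_primePow m⟩
    have hn0 : n ≠ 0 := by omega
    have hdvd : primePow m ∣ n := by
      rw [← Nat.factorization_le_iff_dvd (primePow_ne_zero m) hn0]
      intro p
      by_cases hp : p.Prime
      · obtain ⟨i, rfl⟩ : ∃ i, nthPrime i = p :=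
          ⟨Nat.count Nat.Prime p, Nat.nth_count hp⟩
        have h := hmt i
        rw [← primeLog_primePow m] at h
        exact h
      · rw [Nat.factorization_eq_zero_of_not_prime _ hp]
        exact Nat.zero_le _
    rw [Finset.mem_Icc]
    exact ⟨Nat.one_le_iff_ne_zero.2 (primePow_ne_zero m),
      (Nat.le_of_dvd (Nat.pos_of_ne_zero hn0) hdvd).trans hn.2⟩

/-- `s_k^{j+1}(N)`: the `(j + 1)`-st largest eigenvalue of `L'_k` on `M_N` (zero beyond the number
of eigenvalues). -/
noncomputable def eigenvaluePart (k N j : ℕ) : ℝ := (intMulticomplex N).spectrum' k j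

/-- `t_k^{i+1}(N)`: the `(i + 1)`-st part of the conjugate of the spectrum of `L'_k` on `M_N`. -/
noncomputable def conjugatePart (k N i : ℕ) : ℕ :=
  conjugatePartition ((intMulticomplex N).spectrum' k) i

/-! The eigenvalues are controlled by a recursion for near-cones, phrased through characteristic
polynomials. Since `∂∂*` and `∂*∂` have the same nonzero eigenvalues, it suffices to study the Gram
matrix of the boundaries `∂m`, for `m` in a finite family `F` of monomials.

Suppose that all exponents of variables before `x_r` are even in `F`. Let `B` be the members with
even exponent of `x_r`, and `A` the others divided by `x_r`. For `a` in `A` the boundary is that of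
a cone, `∂(x_r a) = a - x_r ∂a`. If `F` is shifted (replacing an odd variable by an earlier even one
stays in `F`), then `∂b` lies in the span of `A` for every `b` in `B`, and `∂∂ = 0` gives `∂b =
∂(x_r ∂b)`. So the columns of `B` depend on those of `x_r A`: the boundary matrix is `T [1 D]` with
`D` the matrix of `∂` from `B` to `A`. With `E` the boundary matrix of `A`, `TᵀT = 1 + EᵀE` and `ED
= 0`, so the Gram matrix of `F` has the spectrum of `1 + EᵀE + DDᵀ` together with `|B|` zeros
(`exists_charpoly_gramMatrix`).

Because `EᵀE` and `DDᵀ` annihilate each other, the spectrum of their sum is, up to zeros, the union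
of the spectra of `A` and `B`. Adding 1 to `|A|` eigenvalues prepends the part `|A|`, the number of
members odd at `x_r`, to the conjugate partition; the other parts of `A` and `B` add up. Induction
on the variables identifies the conjugate partition with the counts of odd exponents
(`exists_charpoly_eq_natRootsPoly`). Integers up to `N` with fixed `Ω` form a shifted family, as a
prime factor may be replaced by a smaller prime. -/

section LinearAlgebra

open Polynomial

/-! ### Characteristic polynomials of Gram matrices -/

namespace Matrix

variable {R a b u v : Type*} [CommRing R] [Fintype a] [Fintype b] [Fintype u] [Fintype v]
  [DecidableEq a] [DecidableEq b]

/-- Take determinants in `(X - M)(X - N) = X (X - (M + N))`, valid as `MN = 0`. -/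
theorem charpoly_mul_charpoly_of_mul_eq_zero (M N : Matrix a a R) (h : M * N = 0) :
    M.charpoly * N.charpoly = X ^ Fintype.card a * (M + N).charpoly := by
  have key : charmatrix M * charmatrix N = scalar a X * charmatrix (M + N) := by
    have h' : M.map C * N.map C = (0 : Matrix a a R[X]) := by
      rw [← Matrix.map_mul, h]; ext; simp
    have hadd : (M + N).map C = M.map C + N.map C := by ext; simp
    simp only [charmatrix, RingHom.mapMatrix_apply, hadd]
    have hs : M.map C * scalar a (X : R[X]) = scalar a X * M.map C :=
      (scalar_commute X (Commute.all X) _).eq.symm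
    rw [sub_mul, mul_sub, mul_sub, mul_sub, h', hs, mul_add]
    abel
  rw [charpoly, charpoly, charpoly, ← det_mul, key, det_mul]
  simp

theorem charpoly_one_add (M : Matrix a a R) : (1 + M).charpoly = M.charpoly.comp (X - 1) := by
  have h := charpoly_sub_scalar M (-1 : R)
  have e : M - scalar a (-1 : R) = 1 + M := by
    rw [map_neg, map_one]; abel
  rw [e] at h
  rw [h]; simp [sub_eq_add_neg]

/-- The spectrum of the Gram matrix of a near-cone `T * [1 D]`, in terms of the base of the cone
and of the remaining part. -/
theorem charpoly_gram_mul_fromCols (T : Matrix u a R) (E : Matrix v a R) (D : Matrix a b R)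
    (hT : Tᵀ * T = 1 + Eᵀ * E) (h0 : E * D = 0) :
    ((T * fromCols (1 : Matrix a a R) D)ᵀ * (T * fromCols (1 : Matrix a a R) D)).charpoly =
      X ^ Fintype.card b * (Eᵀ * E + D * Dᵀ).charpoly.comp (X - 1) := by
  have h1 : (T * fromCols (1 : Matrix a a R) D)ᵀ * (T * fromCols (1 : Matrix a a R) D) =
      (fromCols (1 : Matrix a a R) D)ᵀ * (Tᵀ * T * fromCols (1 : Matrix a a R) D) := by
    rw [transpose_mul]; simp only [Matrix.mul_assoc]
  -- The product is `(1 + EᵀE)(1 + DDᵀ)`, whose cross term vanishes because `ED = 0`.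
  have h2 : Tᵀ * T * fromCols (1 : Matrix a a R) D * (fromCols (1 : Matrix a a R) D)ᵀ = 1 + (Eᵀ * E + D * Dᵀ) := by
    rw [hT, Matrix.mul_assoc, transpose_fromCols, fromCols_mul_fromRows, transpose_one,
      Matrix.one_mul, add_mul, mul_add, mul_add]
    have : Eᵀ * E * (D * Dᵀ) = 0 := by
      rw [Matrix.mul_assoc, ← Matrix.mul_assoc E, h0]; simp
    rw [this]; simp; abel
  -- Swapping the factors passes from size `|a| + |b|` to size `|a|`, which accounts for `X ^ |b|`.
  rw [h1, charpoly_mul_comm_of_le _ _ (by simp), h2, charpoly_one_add]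
  simp

theorem charpoly_mul_charpoly_gram (E : Matrix v a R) (D : Matrix a b R) (h0 : E * D = 0) :
    (Eᵀ * E).charpoly * (Dᵀ * D).charpoly =
      X ^ Fintype.card b * (Eᵀ * E + D * Dᵀ).charpoly := by
  have h := charpoly_mul_charpoly_of_mul_eq_zero (Eᵀ * E) (D * Dᵀ)
    (by rw [Matrix.mul_assoc, ← Matrix.mul_assoc E, h0]; simp)
  have h' := charpoly_mul_comm' D Dᵀ
  -- Exchanging `DDᵀ` for `DᵀD` leaves a surplus factor `X ^ |a|`; powers of `X` cancel even if `R`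
  -- has zero divisors.
  apply (isRegular_X_pow (R := R) (Fintype.card a)).left
  simp only
  linear_combination (Eᵀ * E).charpoly * (-h') + X ^ Fintype.card b * h

end Matrix

/-! ### Polynomials with natural roots -/

/-- The monic polynomial with a given multiset of natural numbers as its roots. -/
noncomputable def natRootsPoly (s : Multiset ℕ) : ℝ[X] :=
  (s.map fun x : ℕ => X - C (x : ℝ)).prod

theorem natRootsPoly_add (s t : Multiset ℕ) :
    natRootsPoly (s + t) = natRootsPoly s * natRootsPoly t := by
  simp [natRootsPoly]

theorem natRootsPoly_replicate_zero (n : ℕ) : natRootsPoly (Multiset.replicate n 0) = X ^ n := by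
  simp [natRootsPoly]

theorem roots_natRootsPoly (s : Multiset ℕ) :
    (natRootsPoly s).roots = s.map (Nat.cast : ℕ → ℝ) := by
  have : natRootsPoly s = ((s.map (Nat.cast : ℕ → ℝ)).map fun x => X - C x).prod := by
    simp [natRootsPoly]
  rw [this, roots_multiset_prod_X_sub_C]

theorem natRootsPoly_comp (s : Multiset ℕ) :
    (natRootsPoly s).comp (X - 1) = natRootsPoly (s.map (· + 1)) := by
  simp only [natRootsPoly, multiset_prod_comp, Multiset.map_map]
  congr 1
  refine Multiset.map_congr rfl fun x _ => ?_
  simp; ring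

theorem natDegree_natRootsPoly (s : Multiset ℕ) : (natRootsPoly s).natDegree = s.card := by
  have : natRootsPoly s = ((s.map (Nat.cast : ℕ → ℝ)).map fun x => X - C x).prod := by
    simp [natRootsPoly]
  rw [this, natDegree_multiset_prod_X_sub_C_eq_card, Multiset.card_map]

theorem natRootsPoly_ne_zero (s : Multiset ℕ) : natRootsPoly s ≠ 0 :=
  (monic_multiset_prod_of_monic _ _ fun _ _ => monic_X_sub_C _).ne_zero

theorem exists_eq_natRootsPoly_of_X_pow_mul {n : ℕ} {p : ℝ[X]} {s : Multiset ℕ}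
    (h : natRootsPoly s = X ^ n * p) :
    ∃ t, s = t + Multiset.replicate n 0 ∧ p = natRootsPoly t := by
  have hc : n ≤ s.count 0 := by
    have h1 : n ≤ (natRootsPoly s).rootMultiplicity 0 := by
      rw [le_rootMultiplicity_iff (natRootsPoly_ne_zero s), h]
      simp
    rw [← count_roots, roots_natRootsPoly] at h1
    have := Multiset.count_map_eq_count' (Nat.cast : ℕ → ℝ) s Nat.cast_injective 0
    simp only [Nat.cast_zero] at this
    rwa [this] at h1
  obtain ⟨t, ht⟩ := Multiset.le_iff_exists_add.1 (Multiset.le_count_iff_replicate_le.1 hc)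
  refine ⟨t, by rw [ht, add_comm], ?_⟩
  rw [ht, natRootsPoly_add, natRootsPoly_replicate_zero] at h
  exact ((isRegular_X_pow n).left h).symm

end LinearAlgebra

/-! ### The boundary operator and cones -/

namespace Multicomplex

open Finsupp

section Boundary

variable {X : Type*}

/-- The variables of odd exponent in a monomial. -/
noncomputable def oddVars (m : X →₀ ℕ) : Finset X := m.support.filter fun j => Odd (m j)

@[simp] theorem mem_oddVars {m : X →₀ ℕ} {j : X} : j ∈ oddVars m ↔ Odd (m j) := by
  simp only [oddVars, Finset.mem_filter, Finsupp.mem_support_iff, and_iff_right_iff_imp]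
  rintro h h0
  simp [h0] at h

/-- Multiplication of a polynomial by the variable `r`. -/
noncomputable def mulVar (r : X) : ((X →₀ ℕ) →₀ ℝ) →ₗ[ℝ] ((X →₀ ℕ) →₀ ℝ) :=
  Finsupp.lmapDomain ℝ ℝ (· + single r 1)

theorem mulVar_single (r : X) (m : X →₀ ℕ) (c : ℝ) :
    mulVar r (single m c) = single (m + single r 1) c := by
  simp [mulVar]

variable [LinearOrder X]

/-- The sign of the term of the variable `j` in the boundary of a monomial. -/
noncomputable def boundarySign (m : X →₀ ℕ) (j : X) : ℝ :=
  (-1) ^ (∑ i ∈ m.support.filter (fun i => i < j), m i)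

theorem polyBoundary_single (m : X →₀ ℕ) :
    polyBoundary (single m 1) = ∑ j ∈ oddVars m, single (m - single j 1) (boundarySign m j) := by
  simp [polyBoundary, oddVars, boundarySign]

theorem boundarySign_of_even {m : X →₀ ℕ} {r : X} (h : ∀ i < r, Even (m i)) :
    boundarySign m r = 1 := by
  refine Even.neg_one_pow (Finset.even_sum _ fun i hi => h i ?_)
  exact (Finset.mem_filter.1 hi).2

theorem boundarySign_add_single (m : X →₀ ℕ) {r j : X} (h : r < j) :
    boundarySign (m + single r 1) j = - boundarySign m j := by
  have key : ∀ (m' : X →₀ ℕ) (s : Finset X), m'.support ⊆ s →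
      boundarySign m' j = (-1) ^ (∑ i ∈ s.filter (fun i => i < j), m' i) := by
    intro m' s hs
    unfold boundarySign
    congr 1
    refine Finset.sum_subset (Finset.filter_subset_filter _ hs) fun i hi hi' => ?_
    simp only [Finset.mem_filter, Finsupp.mem_support_iff] at hi hi'
    by_contra h0
    exact hi' ⟨h0, hi.2⟩
  -- `r` may or may not occur in `m`, so both exponent sums are taken over a common index set
  -- containing it.
  rw [key _ (insert r m.support), key m (insert r m.support) (Finset.subset_insert _ _)]
  · simp only [Finsupp.add_apply, Finset.sum_add_distrib, pow_add]
    have : ∑ i ∈ (insert r m.support).filter (fun i => i < j), (single r 1 : X →₀ ℕ) i = 1 := by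
      rw [Finset.sum_eq_single_of_mem r (by simp [h])]
      · simp
      · intro b _ hb
        simp [hb]
    rw [this]; ring
  · intro i hi
    simp only [Finset.mem_insert, Finsupp.mem_support_iff, Finsupp.add_apply] at hi ⊢
    by_cases hir : i = r
    · exact Or.inl hir
    · simp [Ne.symm hir] at hi
      exact Or.inr hi

theorem oddVars_add_single {m : X →₀ ℕ} {r : X} (h : Even (m r)) :
    oddVars (m + single r 1) = insert r (oddVars m) := by
  ext j
  by_cases hj : j = r
  · subst hj; simp [h.add_one]
  · simp [hj]

/-- The boundary of a cone. -/
theorem polyBoundary_add_single {m : X →₀ ℕ} {r : X} (h : ∀ i ≤ r, Even (m i)) :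
    polyBoundary (single (m + single r 1) 1) =
      single m 1 - mulVar r (polyBoundary (single m 1)) := by
  have hr : r ∉ oddVars m := by simpa using h r le_rfl
  rw [polyBoundary_single, polyBoundary_single, oddVars_add_single (h r le_rfl),
    Finset.sum_insert hr, add_tsub_cancel_right, boundarySign_of_even, map_sum, sub_eq_add_neg,
    ← Finset.sum_neg_distrib]
  · congr 1
    refine Finset.sum_congr rfl fun j hj => ?_
    have hj' : Odd (m j) := by simpa using hj
    have hrj : r < j := by
      by_contra hc
      exact Nat.not_even_iff_odd.2 hj' (h j (not_lt.1 hc))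
    rw [boundarySign_add_single m hrj, mulVar_single, Finsupp.single_neg]
    congr 2
    ext i
    simp only [Finsupp.add_apply, Finsupp.tsub_apply, Finsupp.single_apply]
    have := hj'.pos
    split_ifs with h1 h2 <;> subst_vars <;> omega
  · intro i hi
    simp [hi.ne', h i hi.le]

theorem exists_of_mem_support_polyBoundary {m u : X →₀ ℕ}
    (hu : u ∈ (polyBoundary (single m 1)).support) :
    ∃ j, Odd (m j) ∧ u = m - single j 1 := by
  classical
  rw [polyBoundary_single] at hu
  obtain ⟨j, hj, hu⟩ := Finset.mem_biUnion.1 (Finsupp.support_finsetSum hu)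
  exact ⟨j, by simpa using hj, Finset.mem_singleton.1 (Finsupp.support_single_subset hu)⟩

theorem even_of_mem_support_polyBoundary {m u : X →₀ ℕ} {i : X} (hi : Even (m i))
    (hu : u ∈ (polyBoundary (single m 1)).support) : Even (u i) := by
  obtain ⟨j, hj, rfl⟩ := exists_of_mem_support_polyBoundary hu
  have : j ≠ i := by
    rintro rfl
    exact Nat.not_even_iff_odd.2 hj hi
  simpa [this] using hi

theorem polyBoundary_eq_sum (f : (X →₀ ℕ) →₀ ℝ) :
    polyBoundary f = f.sum fun m c => c • polyBoundary (single m 1) := by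
  conv_lhs => rw [← Finsupp.sum_single f, Finsupp.sum, map_sum]
  refine Finset.sum_congr rfl fun m _ => ?_
  beta_reduce
  rw [← map_smul]; simp

theorem polyBoundary_mulVar {f : (X →₀ ℕ) →₀ ℝ} {r : X}
    (h : ∀ m ∈ f.support, ∀ i ≤ r, Even (m i)) :
    polyBoundary (mulVar r f) = f - mulVar r (polyBoundary f) := by
  have e : mulVar r f = f.sum fun m c => c • single (m + single r 1) 1 := by
    conv_lhs => rw [← Finsupp.sum_single f, Finsupp.sum, map_sum]
    simp [mulVar_single, Finsupp.sum]
  rw [e, polyBoundary_eq_sum f]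
  conv_rhs => enter [1]; rw [← Finsupp.sum_single f]
  simp only [Finsupp.sum, map_sum, map_smul]
  rw [← Finset.sum_sub_distrib]
  refine Finset.sum_congr rfl fun m hm => ?_
  rw [polyBoundary_add_single (h m hm), smul_sub]
  simp

/-- With `x_r` the first odd variable and `m = x_r a`, the cone formula gives `∂∂m = ∂a - (∂a - x_r
∂∂a) = x_r ∂∂a`, and `a` has one odd variable fewer. -/
theorem polyBoundary_polyBoundary_single (m : X →₀ ℕ) :
    polyBoundary (polyBoundary (single m 1)) = 0 := by
  induction hn : (oddVars m).card generalizing m with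
  | zero => simp [polyBoundary_single, Finset.card_eq_zero.1 hn]
  | succ n ih =>
    have hne : (oddVars m).Nonempty := Finset.card_pos.1 (by omega)
    set r := (oddVars m).min' hne
    have hrm : Odd (m r) := by simpa using (oddVars m).min'_mem hne
    have hlt : ∀ i < r, Even (m i) := by
      intro i hi
      by_contra hc
      exact absurd ((oddVars m).min'_le i (by simpa using hc)) (not_le.2 hi)
    set a := m - single r 1 with ha
    have hma : m = a + single r 1 := by
      ext i
      have := hrm.pos
      simp only [ha, Finsupp.add_apply, Finsupp.tsub_apply, Finsupp.single_apply]
      split_ifs with h <;> subst_vars <;> omega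
    have har : Even (a r) := by
      rw [hma] at hrm
      simpa [Nat.odd_add_one] using hrm
    have hae : ∀ i ≤ r, Even (a i) := by
      intro i hi
      rcases hi.eq_or_lt with rfl | hi
      · exact har
      · have := hlt i hi
        rw [hma] at this
        simpa [hi.ne'] using this
    have hcard : (oddVars a).card = n := by
      rw [hma, oddVars_add_single har, Finset.card_insert_of_notMem (by simpa using har)] at hn
      omega
    have h0 := ih a hcard
    rw [hma, polyBoundary_add_single hae, map_sub, polyBoundary_mulVar, h0]
    · simp
    · intro u hu i hi
      exact even_of_mem_support_polyBoundary (hae i hi) hu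

end Boundary

section Inner

variable {α : Type*}

/-- The inner product for which the monomials are orthonormal. -/
noncomputable def chainInner (f g : α →₀ ℝ) : ℝ := f.sum fun u c => c * g u

theorem chainInner_eq_sum (f g : α →₀ ℝ) {s : Finset α} (hs : f.support ⊆ s) :
    chainInner f g = ∑ u ∈ s, f u * g u :=
  Finsupp.sum_of_support_subset _ hs _ (by simp)

theorem chainInner_comm (f g : α →₀ ℝ) : chainInner f g = chainInner g f := by
  classical
  rw [chainInner_eq_sum f g (Finset.subset_union_left (s₂ := g.support)),
    chainInner_eq_sum g f (Finset.subset_union_right (s₁ := f.support))]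
  exact Finset.sum_congr rfl fun _ _ => mul_comm _ _

theorem chainInner_sub_right (f g h : α →₀ ℝ) :
    chainInner f (g - h) = chainInner f g - chainInner f h := by
  simp [chainInner, Finsupp.sum, mul_sub]

theorem chainInner_sub_left (f g h : α →₀ ℝ) :
    chainInner (f - g) h = chainInner f h - chainInner g h := by
  simp only [chainInner_comm _ h, chainInner_sub_right]

theorem chainInner_single (a : α) (g : α →₀ ℝ) : chainInner (single a 1) g = g a := by
  simp [chainInner]

theorem chainInner_mapDomain {β : Type*} {φ : α → β} (hφ : Function.Injective φ)
    (f g : α →₀ ℝ) : chainInner (mapDomain φ f) (mapDomain φ g) = chainInner f g := by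
  unfold chainInner
  rw [Finsupp.sum_mapDomain_index_inj hφ]
  simp [Finsupp.mapDomain_apply hφ]

end Inner

end Multicomplex

namespace Multicomplex

open Finsupp Polynomial

/-! ### The recursion for near-cones -/

section NearCone

variable {X : Type*}

/-- The monomials of `F` with even exponent of `r`. -/
noncomputable def evenPart (F : Finset (X →₀ ℕ)) (r : X) : Finset (X →₀ ℕ) :=
  F.filter fun m => Even (m r)

theorem mem_evenPart {F : Finset (X →₀ ℕ)} {r : X} {m : X →₀ ℕ} :
    m ∈ evenPart F r ↔ m ∈ F ∧ Even (m r) := by simp [evenPart]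

theorem sub_single_add_single {m : X →₀ ℕ} {r : X} (h : Odd (m r)) :
    m - single r 1 + single r 1 = m :=
  tsub_add_cancel_of_le (by simpa using Nat.one_le_iff_ne_zero.2 h.pos.ne')

theorem sum_boundary_mul {U : Finset (X →₀ ℕ)} {f : (X →₀ ℕ) →₀ ℝ} (hf : f.support ⊆ U)
    (L : ((X →₀ ℕ) →₀ ℝ) →ₗ[ℝ] ((X →₀ ℕ) →₀ ℝ)) (u : X →₀ ℕ) :
    ∑ a : U, L (single a.1 1) u * f a.1 = L f u := by
  rw [Finset.sum_coe_sort U (fun a => L (single a 1) u * f a)]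
  have : f = ∑ a ∈ U, f a • single a 1 := by
    conv_lhs => rw [← Finsupp.sum_single f, Finsupp.sum_of_support_subset _ hf _ (by simp)]
    simp
  conv_rhs => rw [this]
  simp only [map_sum, map_smul, Finsupp.finsetSum_apply, Finsupp.smul_apply, smul_eq_mul,
    mul_comm]

variable [LinearOrder X]

/-- The monomials of `F` with odd exponent of `r`, divided by `r`. -/
noncomputable def linkPart (F : Finset (X →₀ ℕ)) (r : X) : Finset (X →₀ ℕ) :=
  (F.filter fun m => Odd (m r)).image fun m => m - single r 1

theorem mem_linkPart {F : Finset (X →₀ ℕ)} {r : X} {m : X →₀ ℕ} :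
    m ∈ linkPart F r ↔ m + single r 1 ∈ F ∧ Even (m r) := by
  simp only [linkPart, Finset.mem_image, Finset.mem_filter]
  constructor
  · rintro ⟨a, ⟨ha, hr⟩, rfl⟩
    refine ⟨by rwa [sub_single_add_single hr], ?_⟩
    simpa using Nat.Odd.sub_odd hr odd_one
  · rintro ⟨h, hr⟩
    exact ⟨_, ⟨h, by simpa using hr.add_one⟩, by simp⟩

/-- A family of monomials, split into those of odd and of even exponent of `r`. -/
noncomputable def splitEquiv (F : Finset (X →₀ ℕ)) (r : X) :
    linkPart F r ⊕ evenPart F r ≃ F where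
  toFun := Sum.elim (fun a => ⟨a.1 + single r 1, (mem_linkPart.1 a.2).1⟩)
    (fun b => ⟨b.1, (mem_evenPart.1 b.2).1⟩)
  invFun m := if h : Even (m.1 r) then Sum.inr ⟨m.1, mem_evenPart.2 ⟨m.2, h⟩⟩
    else Sum.inl ⟨m.1 - single r 1, Finset.mem_image_of_mem _
      (Finset.mem_filter.2 ⟨m.2, Nat.not_even_iff_odd.1 h⟩)⟩
  left_inv := by
    rintro (a | b)
    · have : ¬ Even (a.1 r + 1) := by simpa [Nat.even_add_one] using (mem_linkPart.1 a.2).2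
      simp [this]
    · simp [(mem_evenPart.1 b.2).2]
  right_inv := by
    intro m
    by_cases h : Even (m.1 r)
    · simp [h]
    · simp [h, sub_single_add_single (Nat.not_even_iff_odd.1 h)]

/-- The matrix of the boundary operator from the span of `F` to the span of `U`. -/
noncomputable def boundaryMatrix (U F : Finset (X →₀ ℕ)) : Matrix U F ℝ :=
  Matrix.of fun u m => polyBoundary (single m.1 1) u.1

/-- The Gram matrix of the boundaries of a family of monomials. -/
noncomputable def gramMatrix (F : Finset (X →₀ ℕ)) : Matrix F F ℝ :=
  Matrix.of fun m m' => chainInner (polyBoundary (single m.1 1)) (polyBoundary (single m'.1 1))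

theorem transpose_mul_boundaryMatrix {U F : Finset (X →₀ ℕ)}
    (h : ∀ m ∈ F, (polyBoundary (single m 1)).support ⊆ U) :
    (boundaryMatrix U F).transpose * boundaryMatrix U F = gramMatrix F := by
  ext m m'
  simp only [Matrix.mul_apply, Matrix.transpose_apply, boundaryMatrix, gramMatrix, Matrix.of_apply]
  rw [chainInner_eq_sum _ _ (h m.1 m.2)]
  exact Finset.sum_coe_sort U
    (fun u => polyBoundary (single m.1 1) u * polyBoundary (single m'.1 1) u)

/-- A finite set that contains the support of the boundary of each monomial of `F`. -/
noncomputable def shadow (F : Finset (X →₀ ℕ)) : Finset (X →₀ ℕ) :=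
  F.biUnion fun m => (polyBoundary (single m 1)).support

theorem support_subset_shadow {F : Finset (X →₀ ℕ)} {m : X →₀ ℕ} (hm : m ∈ F) :
    (polyBoundary (single m 1)).support ⊆ shadow F :=
  Finset.subset_biUnion_of_mem (fun m => (polyBoundary (single m 1)).support) hm

variable {F : Finset (X →₀ ℕ)} {r : X}

theorem even_of_mem_linkPart (hF : ∀ m ∈ F, ∀ i < r, Even (m i)) :
    ∀ m ∈ linkPart F r, ∀ i ≤ r, Even (m i) := by
  intro m hm i hi
  obtain ⟨hm, hr⟩ := mem_linkPart.1 hm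
  rcases hi.eq_or_lt with rfl | hi
  · exact hr
  · simpa [hi.ne'] using hF _ hm i hi

theorem even_of_mem_evenPart (hF : ∀ m ∈ F, ∀ i < r, Even (m i)) :
    ∀ m ∈ evenPart F r, ∀ i ≤ r, Even (m i) := by
  intro m hm i hi
  obtain ⟨hm, hr⟩ := mem_evenPart.1 hm
  rcases hi.eq_or_lt with rfl | hi
  · exact hr
  · exact hF _ hm i hi

/-- This is where shiftedness enters: a term `m / x_j` has `j > r`, and `x_r m / x_j` belongs to
`F`. -/
theorem support_polyBoundary_subset_linkPart (hF : ∀ m ∈ F, ∀ i < r, Even (m i))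
    (hs : ∀ m ∈ F, Even (m r) → ∀ j, r < j → Odd (m j) → m - single j 1 + single r 1 ∈ F)
    {m : X →₀ ℕ} (hm : m ∈ evenPart F r) :
    (polyBoundary (single m 1)).support ⊆ linkPart F r := by
  intro u hu
  have he := even_of_mem_evenPart hF m hm
  have hur := even_of_mem_support_polyBoundary (he r le_rfl) hu
  obtain ⟨j, hj, rfl⟩ := exists_of_mem_support_polyBoundary hu
  obtain ⟨hm, hr⟩ := mem_evenPart.1 hm
  refine mem_linkPart.2 ⟨hs m hm hr j ?_ hj, hur⟩
  by_contra hc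
  exact Nat.not_even_iff_odd.2 hj (he j (not_lt.1 hc))

theorem boundaryMatrix_mul_boundaryMatrix {U : Finset (X →₀ ℕ)} {A B : Finset (X →₀ ℕ)}
    (h : ∀ m ∈ B, (polyBoundary (single m 1)).support ⊆ A) :
    boundaryMatrix U A * boundaryMatrix A B = 0 := by
  ext u b
  simp only [Matrix.mul_apply, boundaryMatrix, Matrix.of_apply]
  rw [sum_boundary_mul (h b.1 b.2), polyBoundary_polyBoundary_single]
  rfl

theorem mulVar_apply_eq_zero {f : (X →₀ ℕ) →₀ ℝ} (hf : ∀ u ∈ f.support, Even (u r))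
    {m : X →₀ ℕ} (hm : Even (m r)) : mulVar r f m = 0 := by
  classical
  by_contra h
  have := Finsupp.mapDomain_support (Finsupp.mem_support_iff.2 h)
  obtain ⟨u, hu, rfl⟩ := Finset.mem_image.1 this
  simp [Nat.even_add_one, hf u hu] at hm

/-- The recursion for the spectra of near-cones: the boundary operator of `F` is determined by
those of its two parts. -/
theorem exists_charpoly_gramMatrix (hF : ∀ m ∈ F, ∀ i < r, Even (m i))
    (hs : ∀ m ∈ F, Even (m r) → ∀ j, r < j → Odd (m j) → m - single j 1 + single r 1 ∈ F) :
    ∃ Q : ℝ[X],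
      (gramMatrix F).charpoly = Polynomial.X ^ (evenPart F r).card * Q.comp (Polynomial.X - 1) ∧
      (gramMatrix (linkPart F r)).charpoly * (gramMatrix (evenPart F r)).charpoly =
        Polynomial.X ^ (evenPart F r).card * Q := by
  have hA := even_of_mem_linkPart hF
  have hB := even_of_mem_evenPart hF
  have hBA := fun m hm => support_polyBoundary_subset_linkPart hF hs (m := m) hm
  set A := linkPart F r
  set B := evenPart F r
  let T : Matrix (shadow F) A ℝ :=
    Matrix.of fun u a => polyBoundary (single (a.1 + single r 1) 1) u.1
  have h0 : boundaryMatrix (shadow A) A * boundaryMatrix A B = 0 :=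
    boundaryMatrix_mul_boundaryMatrix hBA
  have hgA := transpose_mul_boundaryMatrix fun m (hm : m ∈ A) => support_subset_shadow hm
  -- In `∂(x_r a) = a - x_r ∂a` the first term has even and the second odd exponent of `x_r`. The
  -- two are orthogonal, and multiplication by `x_r` is an isometry.
  have hT : T.transpose * T =
      1 + (boundaryMatrix (shadow A) A).transpose * boundaryMatrix (shadow A) A := by
    rw [hgA]
    ext a a'
    have hev : ∀ a : A, ∀ u ∈ (polyBoundary (single a.1 1)).support, Even (u r) :=
      fun a u hu => even_of_mem_support_polyBoundary (hA a.1 a.2 r le_rfl) hu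
    simp only [Matrix.mul_apply, Matrix.transpose_apply, Matrix.add_apply, T, Matrix.of_apply,
      gramMatrix]
    rw [Finset.sum_coe_sort (shadow F) (fun u =>
        polyBoundary (single (a.1 + single r 1) 1) u *
          polyBoundary (single (a'.1 + single r 1) 1) u),
      ← chainInner_eq_sum _ _ (support_subset_shadow (mem_linkPart.1 a.2).1),
      polyBoundary_add_single (hA a.1 a.2), polyBoundary_add_single (hA a'.1 a'.2),
      chainInner_sub_left, chainInner_sub_right, chainInner_sub_right, chainInner_single,
      chainInner_single, chainInner_comm (mulVar r _) (single _ 1), chainInner_single,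
      mulVar_apply_eq_zero (hev a') (hA a.1 a.2 r le_rfl),
      mulVar_apply_eq_zero (hev a) (hA a'.1 a'.2 r le_rfl), mulVar, Finsupp.lmapDomain_apply,
      Finsupp.lmapDomain_apply, chainInner_mapDomain (add_left_injective _), Matrix.one_apply,
      Finsupp.single_apply]
    have : (a'.1 = a.1) = (a = a') := by rw [Subtype.ext_iff, eq_comm (a := a'.1)]
    simp only [sub_zero, zero_sub, sub_neg_eq_add, this]
  -- On the columns of `B` this is `∂b = ∂(x_r ∂b)`.
  have hN : (boundaryMatrix (shadow F) F).submatrix id (splitEquiv F r) =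
      T * Matrix.fromCols 1 (boundaryMatrix A B) := by
    rw [Matrix.mul_fromCols, Matrix.mul_one]
    ext u (a | b)
    · rfl
    · simp only [Matrix.fromCols_apply_inr, Matrix.mul_apply, T, boundaryMatrix, Matrix.of_apply,
        Matrix.submatrix_apply, id]
      have := sum_boundary_mul (hBA b.1 b.2) (polyBoundary ∘ₗ mulVar r) u.1
      simp only [LinearMap.comp_apply, mulVar_single] at this
      rw [this, polyBoundary_mulVar, polyBoundary_polyBoundary_single]
      · simp [splitEquiv]
      · exact fun v hv i hi => even_of_mem_support_polyBoundary (hB b.1 b.2 i hi) hv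
  have hgF : ((boundaryMatrix (shadow F) F).submatrix id (splitEquiv F r)).transpose *
      (boundaryMatrix (shadow F) F).submatrix id (splitEquiv F r) =
      Matrix.reindex (splitEquiv F r).symm (splitEquiv F r).symm (gramMatrix F) := by
    rw [← transpose_mul_boundaryMatrix fun m (hm : m ∈ F) => support_subset_shadow hm]
    rfl
  refine ⟨((boundaryMatrix (shadow A) A).transpose * boundaryMatrix (shadow A) A +
    boundaryMatrix A B * (boundaryMatrix A B).transpose).charpoly, ?_, ?_⟩
  rotate_left
  · rw [← hgA, ← transpose_mul_boundaryMatrix hBA, Matrix.charpoly_mul_charpoly_gram _ _ h0,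
      Fintype.card_coe]
  · rw [← Matrix.charpoly_reindex (splitEquiv F r).symm, ← hgF, hN,
      Matrix.charpoly_gram_mul_fromCols T _ _ hT h0, Fintype.card_coe]

end NearCone

/-! ### Shifted families: induction on the variables -/

/-- The spectrum of a shifted family is conjugate to its degree sequence. -/
theorem exists_charpoly_eq_natRootsPoly (n r : ℕ) (F : Finset (ℕ →₀ ℕ))
    (hF : ∀ m ∈ F, ∀ i < r, Even (m i)) (hn : ∀ m ∈ F, ∀ i, r + n ≤ i → Even (m i))
    (hs : ∀ m ∈ F, ∀ i j, r ≤ i → i < j → Even (m i) → Odd (m j) →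
      m - single j 1 + single i 1 ∈ F) :
    ∃ s : Multiset ℕ, (gramMatrix F).charpoly = natRootsPoly s ∧
      ∀ i, s.countP (i < ·) = (F.filter fun m => Odd (m (r + i))).card := by
  -- `n` bounds the number of variables, from `x_r` on, that can have odd exponent; at `n = 0` every
  -- boundary is zero.
  induction n generalizing r F with
  | zero =>
    have hev : ∀ m ∈ F, ∀ i, Even (m i) := fun m hm i =>
      (lt_or_ge i r).elim (hF m hm i) (hn m hm i)
    refine ⟨Multiset.replicate F.card 0, ?_, fun i => ?_⟩
    · have : gramMatrix F = 0 := by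
        ext m m'
        have : oddVars m.1 = ∅ := by
          ext j; simpa using hev m.1 m.2 j
        simp [gramMatrix, polyBoundary_single, this, chainInner]
      rw [this, Matrix.charpoly_zero, natRootsPoly_replicate_zero, Fintype.card_coe]
    · rw [Finset.filter_false_of_mem fun m hm => by simpa using hev m hm (r + i)]
      simp [Multiset.countP_eq_zero, Multiset.mem_replicate]
  | succ n ih =>
    have hA := even_of_mem_linkPart hF
    have hB := even_of_mem_evenPart hF
    obtain ⟨Q, h1, h2⟩ := exists_charpoly_gramMatrix hF
      fun m hm hr j hj => hs m hm r j le_rfl hj hr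
    obtain ⟨sA, hA1, hA2⟩ := ih (r + 1) (linkPart F r) (fun m hm i hi => hA m hm i (by omega))
      (fun m hm i hi => by
        have hri : r ≠ i := by omega
        simpa [hri] using hn _ (mem_linkPart.1 hm).1 i (by omega))
      (fun m hm i j hi hij hei hoj => by
        have hri : r ≠ i := by omega
        have hrj : r ≠ j := by omega
        obtain ⟨hm, hr⟩ := mem_linkPart.1 hm
        have := hs _ hm i j (by omega) hij (by simpa [hri] using hei) (by simpa [hrj] using hoj)
        refine mem_linkPart.2 ⟨?_, by simpa [hri.symm, hrj.symm] using hr⟩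
        convert this using 1
        ext l
        have := hoj.pos
        simp only [Finsupp.add_apply, Finsupp.tsub_apply, Finsupp.single_apply]
        split_ifs <;> subst_vars <;> omega)
    obtain ⟨sB, hB1, hB2⟩ := ih (r + 1) (evenPart F r) (fun m hm i hi => hB m hm i (by omega))
      (fun m hm i hi => hn _ (mem_evenPart.1 hm).1 i (by omega))
      (fun m hm i j hi hij hei hoj => by
        have hri : r ≠ i := by omega
        have hrj : r ≠ j := by omega
        obtain ⟨hm, hr⟩ := mem_evenPart.1 hm
        exact mem_evenPart.2 ⟨hs _ hm i j (by omega) hij hei hoj,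
          by simpa [hri.symm, hrj.symm] using hr⟩)
    rw [hA1, hB1, ← natRootsPoly_add] at h2
    obtain ⟨t, ht, hQ⟩ := exists_eq_natRootsPoly_of_X_pow_mul h2
    have hinj : Set.InjOn (fun m : ℕ →₀ ℕ => m - single r 1)
        (F.filter fun m => Odd (m r) : Finset _) := by
      intro a ha b hb hab
      simp only [Finset.coe_filter, Set.mem_ofPred_eq] at ha hb
      rw [← sub_single_add_single ha.2, ← sub_single_add_single hb.2]
      exact congrArg (· + single r 1) hab
    have hcardA : (linkPart F r).card = (F.filter fun m => Odd (m r)).card :=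
      Finset.card_image_of_injOn hinj
    refine ⟨t.map (· + 1) + Multiset.replicate (evenPart F r).card 0, ?_, fun i => ?_⟩
    · rw [h1, hQ, natRootsPoly_comp, natRootsPoly_add, natRootsPoly_replicate_zero, mul_comm]
    have hrep : ∀ i, (Multiset.replicate (evenPart F r).card 0).countP (i < ·) = 0 := by
      simp [Multiset.countP_eq_zero, Multiset.mem_replicate]
    rw [Multiset.countP_add, hrep, add_zero, Multiset.countP_map, ← Multiset.countP_eq_card_filter]
    cases i with
    | zero =>
      have hcA : sA.card = (linkPart F r).card := by
        have := congrArg Polynomial.natDegree hA1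
        rw [Matrix.charpoly_natDegree_eq_dim, Fintype.card_coe, natDegree_natRootsPoly] at this
        exact this.symm
      have hcB : sB.card = (evenPart F r).card := by
        have := congrArg Polynomial.natDegree hB1
        rw [Matrix.charpoly_natDegree_eq_dim, Fintype.card_coe, natDegree_natRootsPoly] at this
        exact this.symm
      -- Comparing sizes gives `|t| = |A|`, and each element of `t` becomes positive after adding 1.
      have := congrArg Multiset.card ht
      simp only [Multiset.card_add, Multiset.card_replicate] at this
      rw [Multiset.countP_eq_card.2 (by simp), add_zero, ← hcardA]
      omega
    | succ i =>
      have := congrArg (Multiset.countP (i < ·)) ht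
      simp only [Multiset.countP_add, hA2, hB2, hrep, add_zero] at this
      simp only [add_lt_add_iff_right]
      -- The members odd at `x_(r+i+1)` are counted separately according to the parity of the
      -- exponent of `x_r`.
      rw [← this, show r + 1 + i = r + (i + 1) by omega,
        ← Finset.card_filter_add_card_filter_not (s := F.filter fun m => Odd (m (r + (i + 1))))
          (fun m => Odd (m r))]
      congr 1
      · rw [linkPart, Finset.filter_image, Finset.card_image_of_injOn]
        · simp only [Finset.filter_filter]
          congr 1
          ext m
          simp [and_comm]
        · exact hinj.mono fun m hm => by simp at hm ⊢; exact ⟨hm.1.1, hm.1.2⟩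
      · simp only [evenPart, Finset.filter_filter, Nat.not_odd_iff_even, and_comm]

end Multicomplex

namespace Multicomplex

open Finsupp Polynomial

/-! ### From characteristic polynomials to sorted spectra -/

section Spectrum

/-- The parts of a weakly decreasing list that are at least `y` come first. -/
theorem le_getD_iff_lt_countP {l : List ℝ} (hl : l.Pairwise (· ≥ ·)) {y : ℝ} (hy : 0 < y) (j : ℕ) :
    y ≤ l.getD j 0 ↔ j < l.countP (y ≤ ·) := by
  induction l generalizing j with
  | nil => simpa using hy
  | cons a l ih =>
    obtain ⟨ha, hl⟩ := List.pairwise_cons.1 hl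
    by_cases h : y ≤ a
    · cases j with
      | zero => simp [h]
      | succ j => simpa [h] using ih hl j
    · have h0 : (a :: l).countP (y ≤ ·) = 0 := by
        rw [List.countP_eq_zero]
        intro b hb
        rcases List.mem_cons.1 hb with rfl | hb
        · simpa using h
        · simpa using lt_of_le_of_lt (ha b hb) (not_le.1 h)
      rw [h0]
      simp only [not_lt_zero, iff_false, not_le]
      cases j with
      | zero => simpa using h
      | succ j =>
        have := (ih hl j).not
        rw [List.countP_cons_of_neg (by simpa using h)] at h0
        rw [h0] at this
        simpa using this

/-- Positivity of `y` matters: past the end of the list the value is 0, which must not count as a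
part. -/
theorem le_sort_getD_iff (s : Multiset ℝ) {y : ℝ} (hy : 0 < y) (j : ℕ) :
    y ≤ (s.sort (· ≥ ·)).getD j 0 ↔ j < s.countP (y ≤ ·) := by
  rw [le_getD_iff_lt_countP (s.pairwise_sort (· ≥ ·)) hy]
  conv_rhs => rw [← s.sort_eq (· ≥ ·), Multiset.coe_countP]

theorem conjugatePartition_sort (s : Multiset ℝ) (i : ℕ) :
    conjugatePartition (fun j => (s.sort (· ≥ ·)).getD j 0) i =
      s.countP (((i + 1 : ℕ) : ℝ) ≤ ·) := by
  have : {j : ℕ | ((i + 1 : ℕ) : ℝ) ≤ (s.sort (· ≥ ·)).getD j 0} =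
      Set.Iio (s.countP (((i + 1 : ℕ) : ℝ) ≤ ·)) := by
    ext j
    exact le_sort_getD_iff s (by positivity) j
  rw [conjugatePartition, this, Set.ncard_eq_toFinset_card']
  simp

/-- A partition is the conjugate of its conjugate. -/
theorem sort_getD_eq_ncard {s : Multiset ℝ} (hs : ∀ x ∈ s, ∃ n : ℕ, x = n) (j : ℕ) :
    (s.sort (· ≥ ·)).getD j 0 =
      ({i : ℕ | j + 1 ≤ conjugatePartition (fun j => (s.sort (· ≥ ·)).getD j 0) i}.ncard : ℝ) := by
  obtain ⟨n, hn⟩ : ∃ n : ℕ, (s.sort (· ≥ ·)).getD j 0 = n := by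
    by_cases hj : j < (s.sort (· ≥ ·)).length
    · rw [List.getD_eq_getElem _ _ hj]
      exact hs _ ((Multiset.mem_sort _).1 (List.getElem_mem hj))
    · exact ⟨0, by rw [List.getD_eq_default _ _ (not_lt.1 hj)]; simp⟩
  -- Both conditions say that the part of index `j` is at least `i + 1`; integrality turns this into
  -- `i < n`.
  have : {i : ℕ | j + 1 ≤ conjugatePartition (fun j => (s.sort (· ≥ ·)).getD j 0) i} =
      Set.Iio n := by
    ext i
    change j + 1 ≤ conjugatePartition _ i ↔ i < n
    rw [conjugatePartition_sort, Nat.succ_le_iff, ← le_sort_getD_iff s (by positivity), hn,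
      Nat.cast_le, Nat.succ_le_iff]
  rw [this, hn, Set.ncard_eq_toFinset_card']
  simp

variable {X : Type*} [LinearOrder X]

theorem charpoly_laplacian' (M : Multicomplex X) (d : ℕ) :
    (M.laplacian' d).charpoly = (boundaryMatrix (M.level d) (M.level (d + 1)) *
      (boundaryMatrix (M.level d) (M.level (d + 1))).transpose).charpoly := by
  set D := boundaryMatrix (M.level d) (M.level (d + 1))
  have h1 : M.boundary d = Matrix.toEuclideanLin D := rfl
  rw [laplacian', h1, ← Matrix.toEuclideanLin_conjTranspose_eq_adjoint,
    Matrix.conjTranspose_eq_transpose_of_trivial]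
  erw [← Matrix.toLpLin_mul]
  rw [Matrix.toLpLin_eq_toLin, Matrix.charpoly_toLin]

/-- The nonzero eigenvalues of `∂ ∂^*` and of the Gram matrix of the boundaries agree. -/
theorem eigenvalues'_add_replicate (M : Multicomplex X) (d : ℕ) {s : Multiset ℕ}
    (hs : (gramMatrix (M.level (d + 1))).charpoly = natRootsPoly s) :
    M.eigenvalues' d + Multiset.replicate (M.level (d + 1)).card 0 =
      s.map Nat.cast + Multiset.replicate (M.level d).card 0 := by
  have h := Matrix.charpoly_mul_comm' (boundaryMatrix (M.level d) (M.level (d + 1)))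
    (boundaryMatrix (M.level d) (M.level (d + 1))).transpose
  rw [transpose_mul_boundaryMatrix (support_polyBoundary M d), hs, ← charpoly_laplacian',
    Fintype.card_coe, Fintype.card_coe] at h
  have h' := congrArg Polynomial.roots h
  rw [roots_mul (mul_ne_zero (pow_ne_zero _ X_ne_zero) (LinearMap.charpoly_monic _).ne_zero),
    roots_mul (mul_ne_zero (pow_ne_zero _ X_ne_zero) (natRootsPoly_ne_zero s)),
    roots_X_pow, roots_X_pow, roots_natRootsPoly] at h'
  rw [add_comm, add_comm (s.map _)]
  simpa [Multiset.nsmul_singleton, eigenvalues'] using h'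

theorem exists_natCast_of_mem_eigenvalues' (M : Multicomplex X) (d : ℕ) {s : Multiset ℕ}
    (hs : (gramMatrix (M.level (d + 1))).charpoly = natRootsPoly s) :
    ∀ x ∈ M.eigenvalues' d, ∃ n : ℕ, x = n := by
  intro x hx
  have hx' := Multiset.mem_add.2 (Or.inl hx (b := x ∈ Multiset.replicate (M.level (d + 1)).card 0))
  rw [eigenvalues'_add_replicate M d hs, Multiset.mem_add, Multiset.mem_map] at hx'
  rcases hx' with ⟨n, _, rfl⟩ | h
  · exact ⟨n, rfl⟩
  · exact ⟨0, by simpa using Multiset.eq_of_mem_replicate h⟩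

/-- The conjugate counts only parts that are at least 1, so the zeros by which the two spectra
differ are invisible to it. -/
theorem conjugatePartition_spectrum' (M : Multicomplex X) (d : ℕ) {s : Multiset ℕ}
    (hs : (gramMatrix (M.level (d + 1))).charpoly = natRootsPoly s) (i : ℕ) :
    conjugatePartition (M.spectrum' d) i = s.countP (i < ·) := by
  refine (conjugatePartition_sort _ i).trans ?_
  have h := congrArg (Multiset.countP (((i + 1 : ℕ) : ℝ) ≤ ·)) (eigenvalues'_add_replicate M d hs)
  have h0 : ∀ n, (Multiset.replicate n (0 : ℝ)).countP (((i + 1 : ℕ) : ℝ) ≤ ·) = 0 := by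
    intro n
    rw [Multiset.countP_eq_zero]
    intro a ha
    rw [Multiset.eq_of_mem_replicate ha, not_le]
    positivity
  rw [Multiset.countP_add, Multiset.countP_add, h0, h0, add_zero, add_zero, Multiset.countP_map,
    ← Multiset.countP_eq_card_filter] at h
  rw [h]
  exact Multiset.countP_congr rfl fun n _ => by rw [Nat.cast_le, Nat.succ_le_iff]

/-- A shifted multicomplex is Laplacian integral, and its spectrum is conjugate to the numbers of
its monomials in which a given variable has odd exponent. -/
theorem exists_spectrum_of_shifted (M : Multicomplex ℕ) (d n : ℕ)
    (hn : ∀ m ∈ M.level (d + 1), ∀ i, n ≤ i → Even (m i))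
    (hs : ∀ m ∈ M.level (d + 1), ∀ i j, i < j → Even (m i) → Odd (m j) →
      m - single j 1 + single i 1 ∈ M.level (d + 1)) :
    (∀ x ∈ M.eigenvalues' d, ∃ n : ℕ, x = n) ∧
    ∀ i, conjugatePartition (M.spectrum' d) i =
      ((M.level (d + 1)).filter fun m => Odd (m i)).card := by
  obtain ⟨s, h1, h2⟩ := exists_charpoly_eq_natRootsPoly n 0 (M.level (d + 1)) (by simp)
    (by simpa using hn) fun m hm i j _ => hs m hm i j
  refine ⟨exists_natCast_of_mem_eigenvalues' M d h1, fun i => ?_⟩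
  rw [conjugatePartition_spectrum' M d h1, h2, zero_add]

end Spectrum

end Multicomplex

/-! ### The multicomplex of the integers up to `N` -/

section Integers

open Finsupp

theorem nthPrime_strictMono : StrictMono nthPrime := Nat.nth_strictMono Nat.infinite_setOfPred_prime

theorem mapDomain_primeLog (n : ℕ) : (primeLog n).mapDomain nthPrime = n.factorization := by
  refine Finsupp.mapDomain_comapDomain _ nthPrime_injective _ fun p hp => ?_
  have hp : p.Prime := Nat.prime_of_mem_primeFactors (by simpa using hp)
  exact ⟨Nat.count Nat.Prime p, Nat.nth_count hp⟩

theorem primeLog_injOn : Set.InjOn primeLog {n | n ≠ 0} := by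
  intro a ha b hb h
  refine Nat.eq_of_factorization_eq ha hb fun p => ?_
  rw [← mapDomain_primeLog, h, mapDomain_primeLog]

theorem primePow_primeLog {n : ℕ} (hn : n ≠ 0) : primePow (primeLog n) = n :=
  primeLog_injOn (primePow_ne_zero _) hn (primeLog_primePow _)

theorem primePow_add_single (α : ℕ →₀ ℕ) (i : ℕ) :
    primePow (α + single i 1) = primePow α * nthPrime i := by
  unfold primePow
  rw [Finsupp.prod_add_index' (by simp) fun _ _ _ => pow_add _ _ _]
  simp

theorem degree_primeLog (n : ℕ) :
    (primeLog n).degree = ArithmeticFunction.cardFactors n := by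
  rw [ArithmeticFunction.cardFactors_eq_sum_factorization, ← mapDomain_primeLog,
    Finsupp.sum_mapDomain_index (by simp) (by simp)]
  rfl

theorem level_intMulticomplex (N d : ℕ) :
    (intMulticomplex N).level d = ((Finset.Icc 1 N).filter fun l =>
      ArithmeticFunction.cardFactors l = d).image primeLog := by
  simp only [Multicomplex.level, intMulticomplex, Finset.filter_image, degree_primeLog]

theorem mem_level_intMulticomplex {N d : ℕ} {m : ℕ →₀ ℕ} :
    m ∈ (intMulticomplex N).level d ↔ primePow m ≤ N ∧ m.degree = d := by
  rw [level_intMulticomplex]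
  simp only [Finset.mem_image, Finset.mem_filter, Finset.mem_Icc]
  constructor
  · rintro ⟨n, ⟨⟨h1, h2⟩, h3⟩, rfl⟩
    rw [primePow_primeLog (by omega), degree_primeLog]
    exact ⟨h2, h3⟩
  · rintro ⟨h1, h2⟩
    refine ⟨primePow m, ⟨⟨Nat.one_le_iff_ne_zero.2 (primePow_ne_zero m), h1⟩, ?_⟩,
      primeLog_primePow m⟩
    rw [← degree_primeLog, primeLog_primePow, h2]

/-- Replacing a prime factor by a smaller prime decreases the integer and keeps `Ω`. -/
theorem shifted_level_intMulticomplex {N d : ℕ} {m : ℕ →₀ ℕ}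
    (hm : m ∈ (intMulticomplex N).level d) {i j : ℕ} (hij : i < j) (hj : Odd (m j)) :
    m - single j 1 + single i 1 ∈ (intMulticomplex N).level d := by
  obtain ⟨h1, h2⟩ := mem_level_intMulticomplex.1 hm
  rw [← Multicomplex.sub_single_add_single hj] at h1 h2
  rw [primePow_add_single] at h1
  refine mem_level_intMulticomplex.2 ⟨?_, by simpa using h2⟩
  rw [primePow_add_single]
  exact (Nat.mul_le_mul_left _ (nthPrime_strictMono hij).le).trans h1

theorem eq_zero_of_mem_level_intMulticomplex {N d : ℕ} {m : ℕ →₀ ℕ}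
    (hm : m ∈ (intMulticomplex N).level d) {i : ℕ} (hi : N + 1 ≤ i) : m i = 0 := by
  obtain ⟨h1, -⟩ := mem_level_intMulticomplex.1 hm
  rw [← primeLog_primePow m, primeLog_apply]
  refine Nat.factorization_eq_zero_of_lt ?_
  -- The prime of index `i` is at least `i`, hence exceeds `N`.
  have := nthPrime_strictMono.le_apply (x := i)
  omega

theorem nthPrime_dvd_squarefreePart (i n : ℕ) :
    nthPrime i ∣ squarefreePart n ↔ Odd (primeLog n i) := by
  rw [squarefreePart, (nthPrime_prime i).dvd_iff_one_le_factorization (primePow_ne_zero _),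
    ← primeLog_apply, primeLog_primePow, parityVector, Finsupp.mapRange_apply, Nat.odd_iff]
  omega

theorem card_filter_odd_level (N d i : ℕ) :
    (((intMulticomplex N).level d).filter fun m => Odd (m i)).card =
      (((Finset.Icc 1 N).filter fun l => ArithmeticFunction.cardFactors l = d).filter
        fun l => Odd (primeLog l i)).card := by
  rw [level_intMulticomplex, Finset.filter_image, Finset.card_image_of_injOn]
  refine primeLog_injOn.mono fun l hl => ?_
  simp only [Finset.coe_filter, Finset.mem_filter, Finset.mem_Icc, Set.mem_ofPred_eq] at hl ⊢
  omega

theorem card_filter_odd_level_eq_ncard (N k i : ℕ) :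
    (((intMulticomplex N).level (k + 1)).filter fun m => Odd (m i)).card =
      {n : ℕ | 1 < n ∧ n ≤ N ∧ ArithmeticFunction.cardFactors n = k + 1 ∧
        nthPrime i ∣ squarefreePart n}.ncard := by
  rw [card_filter_odd_level, ← Set.ncard_coe_finset]
  congr 1
  ext n
  simp only [Finset.coe_filter, Finset.mem_filter, Finset.mem_Icc, Set.mem_ofPred_eq,
    nthPrime_dvd_squarefreePart]
  constructor
  · rintro ⟨⟨⟨h1, h2⟩, h3⟩, h4⟩
    refine ⟨lt_of_le_of_ne h1 ?_, h2, h3, h4⟩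
    -- The integer 1 drops out since `Ω(1) = 0` differs from `k + 1`.
    rintro rfl
    simp at h3
  · rintro ⟨h1, h2, h3, h4⟩
    exact ⟨⟨⟨h1.le, h2⟩, h3⟩, h4⟩

theorem card_filter_odd_level_eq_sum (N k i : ℕ) :
    (((intMulticomplex N).level (k + 1)).filter fun m => Odd (m i)).card =
      (∑ l ∈ (Finset.Icc 1 N).filter (fun l => ArithmeticFunction.cardFactors l = k + 1),
        parityVector (primeLog l)) i := by
  rw [card_filter_odd_level, Finset.card_filter, Finsupp.finsetSum_apply]
  refine Finset.sum_congr rfl fun l _ => ?_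
  rw [parityVector, Finsupp.mapRange_apply]
  split_ifs with h
  · exact (Nat.odd_iff.1 h).symm
  · exact (Nat.even_iff.1 (Nat.not_odd_iff_even.1 h)).symm

end Integers

theorem mainTheorem2 (N : ℕ) (hN : 0 < N) (k : ℕ) :
    -- the spectrum of `L'_k` consists of nonnegative integers, i.e. it is a partition
    (∀ x ∈ (intMulticomplex N).eigenvalues' k, ∃ n : ℕ, x = n) ∧
    -- its conjugate partition is a sum of exponent vectors
    (conjugatePartition ((intMulticomplex N).spectrum' k) =
      ⇑(∑ l ∈ (Finset.Icc 1 N).filter (fun l => ArithmeticFunction.cardFactors l = k + 1),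
        parityVector (primeLog l))) ∧
    (conjugatePartition ((intMulticomplex N).spectrum' k) =
      ⇑(∑ l ∈ (Finset.Icc 1 N).filter (fun l => ArithmeticFunction.cardFactors l = k + 1),
        primeLog (squarefreePart l))) ∧
    -- the parts of the conjugate partition
    (∀ i : ℕ, conjugatePart k N i =
      {n : ℕ | 1 < n ∧ n ≤ N ∧ ArithmeticFunction.cardFactors n = k + 1 ∧
        nthPrime i ∣ squarefreePart n}.ncard) ∧
    -- the eigenvalues
    (∀ j : ℕ, eigenvaluePart k N j = ({i : ℕ | j + 1 ≤ conjugatePart k N i}.ncard : ℝ)) ∧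
    (∀ j : ℕ, eigenvaluePart k N j =
      ({i : ℕ | j + 1 ≤ {n : ℕ | 1 < n ∧ n ≤ N ∧ ArithmeticFunction.cardFactors n = k + 1 ∧
        nthPrime i ∣ squarefreePart n}.ncard}.ncard : ℝ)) := by
  obtain ⟨h1, h2⟩ := Multicomplex.exists_spectrum_of_shifted (intMulticomplex N) k (N + 1)
    (fun m hm i hi => by simp [eq_zero_of_mem_level_intMulticomplex hm hi])
    (fun m hm i j hij _ hj => shifted_level_intMulticomplex hm hij hj)
  have hsum := funext fun i => (h2 i).trans (card_filter_odd_level_eq_sum N k i)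
  have hcard := fun i => (h2 i).trans (card_filter_odd_level_eq_ncard N k i)
  have hpart : ∀ j : ℕ, eigenvaluePart k N j =
      ({i : ℕ | j + 1 ≤ conjugatePart k N i}.ncard : ℝ) :=
    Multicomplex.sort_getD_eq_ncard h1
  refine ⟨h1, hsum, ?_, hcard, hpart, fun j => ?_⟩
  · simpa only [squarefreePart, primeLog_primePow] using hsum
  · rw [hpart]
    simp only [conjugatePart, hcard]
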